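/- For $n\ge 0$ let $a_n\in\{0,1\}$ be the $n$-th term of the Thue–Morse sequence, that is, the sum of the binary digits of $n$ reduced modulo $2$. Let $\alpha\in\mathbb{C}$ be algebraic over $\mathbb{Q}$ with $0<|\alpha|<1$. Then the infinite product and the series $$f_{\mathrm{TM}}(\alpha)=\prod_{n=0}^{\infty}\bigl(1-\alpha^{2^n}\bigr)=\sum_{n=0}^{\infty}(-1)^{a_n}\alpha^n$$ converge (unconditionally) to the same complex number $f_{\mathrm{TM}}(\alpha)$, and this number is transcendental over $\mathbb{Q}$. -/

import Mathlib

/-- The Thue–Morse sequence: the sum of the binary digits of `n`, reduced modulo `2`. -/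
def thueMorse (n : ℕ) : ℕ := (Nat.digits 2 n).sum % 2

/-- The Thue–Morse function `x ↦ ∏_{n ≥ 0} (1 - x ^ (2 ^ n))` on the complex numbers. It is used
only in the open unit disc, where the product converges. -/
noncomputable def fTM (x : ℂ) : ℂ := ∏' n : ℕ, (1 - x ^ (2 ^ n))

open Filter Topology PowerSeries

/-! ### The Thue–Morse product and series -/

/-! This is Mahler's method, driven by the functional equation `f(z) = P_k(z) f(z ^ 2 ^ k)` with
`P_k = tmProd k` and `f = fTM` (`fTM_eq_tmProd_mul`).

The function `f` is transcendental over the polynomials, because it vanishes to infinite order at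
`1` (`eval₂_tmSeries_ne_zero`). Hence, by counting unknowns, some nonzero `E(z) = ∑ tᵢⱼ zⁱ f(z)ʲ`
with `i, j ≤ p` vanishes to order at least `p ^ 2` at `0` (`exists_auxiliary_series`). For large
`k`, `E(α ^ 2 ^ k)` is nonzero and at most `M ‖α‖ ^ (2 ^ k p ^ 2)`.

If `α` and `f(α)` were both algebraic, then `P_k(α) ^ p E(α ^ 2 ^ k)` would be a polynomial in them
whose denominator and conjugates are at most exponential in `2 ^ k p`. The norm inequality
`one_le_norm_mul_pow_of_isIntegral` then bounds it below by an exponential in `-2 ^ k p`. For `p`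
large, and then `k` large, this contradicts the upper bound. -/

theorem neg_one_pow_thueMorse (n : ℕ) :
    (-1 : ℤ) ^ thueMorse n = (-1) ^ (Nat.digits 2 n).sum := by
  rw [thueMorse, ← neg_one_pow_eq_pow_mod_two]

theorem neg_one_pow_thueMorse_two_mul (n : ℕ) :
    (-1 : ℤ) ^ thueMorse (2 * n) = (-1) ^ thueMorse n := by
  rcases Nat.eq_zero_or_pos n with rfl | hn
  · rfl
  · simp only [neg_one_pow_thueMorse]
    rw [Nat.digits_base_mul (by norm_num) hn]
    simp

theorem neg_one_pow_thueMorse_two_mul_add_one (n : ℕ) :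
    (-1 : ℤ) ^ thueMorse (2 * n + 1) = -(-1) ^ thueMorse n := by
  simp only [neg_one_pow_thueMorse]
  have h1 : (2 * n + 1) % 2 = 1 := by omega
  have h2 : (2 * n + 1) / 2 = n := by omega
  rw [show Nat.digits 2 (2 * n + 1) = _ from Nat.digits_add_two_add_one 0 (2 * n), h1, h2]
  simp [pow_add]

/-- The finite product `∏_{i < k} (1 - x ^ (2 ^ i))`. -/
def tmProd {R : Type*} [CommRing R] (k : ℕ) (x : R) : R :=
  ∏ i ∈ Finset.range k, (1 - x ^ (2 ^ i))

theorem tmProd_succ' {R : Type*} [CommRing R] (k : ℕ) (x : R) :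
    tmProd (k + 1) x = (1 - x) * tmProd k (x ^ 2) := by
  rw [tmProd, Finset.prod_range_succ', mul_comm]
  simp only [tmProd, ← pow_mul, ← pow_succ', pow_zero, pow_one]

theorem tmProd_add {R : Type*} [CommRing R] (k l : ℕ) (x : R) :
    tmProd (k + l) x = tmProd k x * tmProd l (x ^ (2 ^ k)) := by
  simp only [tmProd, Finset.prod_range_add, ← pow_mul, ← pow_add]

theorem sum_range_two_mul {M : Type*} [AddCommMonoid M] (f : ℕ → M) (n : ℕ) :
    ∑ i ∈ Finset.range (2 * n), f i = ∑ i ∈ Finset.range n, (f (2 * i) + f (2 * i + 1)) := by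
  induction n with
  | zero => simp
  | succ n ih =>
    rw [Nat.mul_succ, Finset.sum_range_succ, Finset.sum_range_succ, ih, Finset.sum_range_succ,
      add_assoc]

/-- The factor `1 - x` in `P_{k+1}(x) = (1 - x) P_k(x ^ 2)` splits the sum into even and odd
indices, with opposite signs. -/
theorem tmProd_eq_sum {R : Type*} [CommRing R] (k : ℕ) (x : R) :
    tmProd k x = ∑ n ∈ Finset.range (2 ^ k), ((-1 : ℤ) ^ thueMorse n : ℤ) * x ^ n := by
  induction k generalizing x with
  | zero => simp [tmProd, thueMorse]
  | succ k ih =>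
    rw [tmProd_succ', ih, pow_succ' 2 k, sum_range_two_mul, Finset.mul_sum]
    refine Finset.sum_congr rfl fun n _ => ?_
    rw [neg_one_pow_thueMorse_two_mul, neg_one_pow_thueMorse_two_mul_add_one]
    push_cast
    ring

theorem hasProd_fTM {z : ℂ} (hz : ‖z‖ < 1) : HasProd (fun n : ℕ => 1 - z ^ (2 ^ n)) (fTM z) := by
  have hs : Summable fun n : ℕ => -z ^ (2 ^ n) := by
    refine (Summable.of_norm ?_).neg
    simp only [norm_pow]
    exact (summable_geometric_of_lt_one (norm_nonneg z) hz).comp_injective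
      (Nat.pow_right_injective le_rfl)
  have := (Complex.multipliable_one_add_of_summable hs).hasProd
  simpa only [fTM, ← sub_eq_add_neg] using this

theorem tendsto_tmProd {z : ℂ} (hz : ‖z‖ < 1) :
    Tendsto (fun k => tmProd k z) atTop (𝓝 (fTM z)) :=
  (hasProd_fTM hz).tendsto_prod_nat

theorem fTM_eq_tmProd_mul {z : ℂ} (hz : ‖z‖ < 1) (k : ℕ) :
    fTM z = tmProd k z * fTM (z ^ (2 ^ k)) := by
  have hz' : ‖z ^ (2 ^ k)‖ < 1 := by
    rw [norm_pow]; exact pow_lt_one₀ (norm_nonneg z) hz (by positivity)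
  refine tendsto_nhds_unique ((tendsto_tmProd hz).comp (tendsto_add_atTop_nat k)) ?_
  refine ((tendsto_tmProd hz').const_mul (tmProd k z)).congr fun l => ?_
  rw [Function.comp_apply, add_comm, tmProd_add]

/-! ### Evaluating integral power series at complex numbers -/

/-- The integral power series `φ` converges absolutely at `z`, with sum `v`. -/
def HasSumAt (φ : ℤ⟦X⟧) (z v : ℂ) : Prop :=
  (Summable fun n => ‖((coeff n φ : ℤ) : ℂ) * z ^ n‖) ∧ HasSum (fun n => ((coeff n φ : ℤ) : ℂ) * z ^ n) v

namespace HasSumAt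

variable {φ ψ : ℤ⟦X⟧} {z v w : ℂ}

theorem add (h : HasSumAt φ z v) (h' : HasSumAt ψ z w) : HasSumAt (φ + ψ) z (v + w) := by
  have e : (fun n => ((coeff n (φ + ψ) : ℤ) : ℂ) * z ^ n) =
      fun n => ((coeff n φ : ℤ) : ℂ) * z ^ n + ((coeff n ψ : ℤ) : ℂ) * z ^ n := by
    ext n; rw [map_add]; push_cast; ring
  refine ⟨?_, e ▸ h.2.add h'.2⟩
  refine Summable.of_nonneg_of_le (fun n => norm_nonneg _) (fun n => ?_) (h.1.add h'.1)
  rw [congrFun e n]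
  exact norm_add_le _ _

theorem mul (h : HasSumAt φ z v) (h' : HasSumAt ψ z w) : HasSumAt (φ * ψ) z (v * w) := by
  have e : (fun n => ((coeff n (φ * ψ) : ℤ) : ℂ) * z ^ n) =
      fun n => ∑ kl ∈ Finset.HasAntidiagonal.antidiagonal n,
        (((coeff kl.1 φ : ℤ) : ℂ) * z ^ kl.1) * (((coeff kl.2 ψ : ℤ) : ℂ) * z ^ kl.2) := by
    ext n
    rw [coeff_mul]
    push_cast
    rw [Finset.sum_mul]
    refine Finset.sum_congr rfl fun kl hkl => ?_
    rw [← Finset.HasAntidiagonal.mem_antidiagonal.mp hkl, pow_add]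
    ring
  have hs := summable_norm_sum_mul_antidiagonal_of_summable_norm h.1 h'.1
  refine ⟨hs.congr fun n => congrArg norm (congrFun e n).symm, ?_⟩
  rw [e, ← h.2.tsum_eq, ← h'.2.tsum_eq,
    tsum_mul_tsum_eq_tsum_sum_antidiagonal_of_summable_norm h.1 h'.1]
  exact hs.of_norm.hasSum

theorem monomial (m : ℕ) (a : ℤ) (z : ℂ) : HasSumAt (PowerSeries.monomial m a) z (a * z ^ m) := by
  have h0 : ∀ n, n ≠ m → ((coeff n (PowerSeries.monomial m a) : ℤ) : ℂ) * z ^ n = 0 := by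
    intro n hn
    rw [coeff_monomial, if_neg hn]
    simp
  refine ⟨(hasSum_single m fun n hn => by rw [h0 n hn, norm_zero]).summable, ?_⟩
  have := hasSum_single m h0
  rwa [coeff_monomial_same] at this

theorem C (a : ℤ) (z : ℂ) : HasSumAt (PowerSeries.C a) z a := by
  simpa using monomial 0 a z

theorem X (z : ℂ) : HasSumAt (PowerSeries.X : ℤ⟦X⟧) z z := by
  simpa [PowerSeries.X_eq] using monomial 1 1 z

theorem pow (h : HasSumAt φ z v) (n : ℕ) : HasSumAt (φ ^ n) z (v ^ n) := by
  induction n with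
  | zero => simpa using C 1 z
  | succ n ih => simpa only [pow_succ] using ih.mul h

theorem sum {ι : Type*} (s : Finset ι) {φ : ι → ℤ⟦X⟧} {v : ι → ℂ}
    (h : ∀ i ∈ s, HasSumAt (φ i) z (v i)) : HasSumAt (∑ i ∈ s, φ i) z (∑ i ∈ s, v i) := by
  classical
  induction s using Finset.induction_on with
  | empty => simpa using C 0 z
  | insert a s ha ih =>
    rw [Finset.sum_insert ha, Finset.sum_insert ha]
    exact (h a (Finset.mem_insert_self a s)).add
      (ih fun i hi => h i (Finset.mem_insert_of_mem hi))

theorem polynomial (P : Polynomial ℤ) (z : ℂ) : HasSumAt P z (Polynomial.aeval z P) := by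
  induction P using Polynomial.induction_on' with
  | add p q hp hq => simpa using hp.add hq
  | monomial n a => simpa [Polynomial.aeval_monomial] using monomial n a z

theorem eq (h : HasSumAt φ z v) (h' : HasSumAt φ z w) : v = w := h.2.unique h'.2

/-- A nonzero power series vanishing to order at least `q` at the origin is nonzero and
`O(‖z‖ ^ q)` on a punctured neighbourhood of the origin. -/
theorem exists_bound_nhdsNE_zero {φ : ℤ⟦X⟧} (hφ : φ ≠ 0) {q : ℕ} (hq : ∀ n < q, coeff n φ = 0)
    {r v₀ : ℂ} (hr0 : r ≠ 0) (hr1 : ‖r‖ < 1) (hr : HasSumAt φ r v₀) :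
    ∃ M : ℝ, ∀ᶠ z in 𝓝[≠] (0 : ℂ), ∀ v, HasSumAt φ z v → v ≠ 0 ∧ ‖v‖ ≤ M * ‖z‖ ^ q := by
  classical
  have hex : ∃ m, coeff m φ ≠ 0 := by
    by_contra! h
    exact hφ (PowerSeries.ext (by simpa using h))
  set m := Nat.find hex with hm
  have hqm : q ≤ m := by
    by_contra! h
    exact Nat.find_spec hex (hq _ h)
  have hlow : ∀ n < m, coeff n φ = 0 := fun n hn => not_not.mp (Nat.find_min hex hn)
  have ham : coeff m φ ≠ 0 := Nat.find_spec hex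
  have hr0' : 0 < ‖r‖ := norm_pos_iff.mpr hr0
  -- Absolute convergence at `r` bounds the tail beyond the leading term by `T ‖z‖ ^ (m + 1)`,
  -- uniformly for `‖z‖ ≤ ‖r‖`.
  have hT : Summable fun n => ‖((coeff (n + (m + 1)) φ : ℤ) : ℂ)‖ * ‖r‖ ^ n := by
    have := ((summable_nat_add_iff (m + 1)).mpr hr.1).mul_right ((‖r‖ ^ (m + 1))⁻¹)
    refine this.congr fun n => ?_
    rw [norm_mul, norm_pow, pow_add]
    field_simp
  set T := ∑' n, ‖((coeff (n + (m + 1)) φ : ℤ) : ℂ)‖ * ‖r‖ ^ n with hTdef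
  have hT0 : 0 ≤ T := tsum_nonneg fun n => by positivity
  have key : ∀ z v, ‖z‖ ≤ ‖r‖ → HasSumAt φ z v →
      ‖v - ((coeff m φ : ℤ) : ℂ) * z ^ m‖ ≤ T * ‖z‖ ^ (m + 1) := by
    intro z v hz hv
    have h1 := (hasSum_nat_add_iff' (m + 1)).mpr hv.2
    rw [Finset.sum_range_succ, Finset.sum_eq_zero, zero_add] at h1
    swap
    · intro n hn
      rw [hlow n (Finset.mem_range.mp hn)]; simp
    refine h1.norm_le_of_bounded (hT.hasSum.mul_right (‖z‖ ^ (m + 1))) fun n => ?_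
    rw [norm_mul, norm_pow, pow_add, ← mul_assoc]
    gcongr
  refine ⟨‖((coeff m φ : ℤ) : ℂ)‖ + T, ?_⟩
  -- On this radius `T ‖z‖ < 1`, while the leading coefficient, a nonzero integer, has norm at least
  -- `1`: the leading term dominates.
  have hε : 0 < min ‖r‖ (1 / (T + 1)) := lt_min hr0' (by positivity)
  have hball : ∀ᶠ z in 𝓝[≠] (0 : ℂ), ‖z‖ < min ‖r‖ (1 / (T + 1)) := by
    refine eventually_nhdsWithin_of_eventually_nhds ?_
    filter_upwards [Metric.ball_mem_nhds (0 : ℂ) hε] with z hz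
    simpa using hz
  filter_upwards [hball, self_mem_nhdsWithin] with z hz hz0 v hv
  have hz0' : 0 < ‖z‖ := norm_pos_iff.mpr hz0
  have hzr : ‖z‖ ≤ ‖r‖ := (hz.trans_le (min_le_left _ _)).le
  have hzT : ‖z‖ * (T + 1) < 1 := by
    rw [← lt_div_iff₀ (by positivity)]; exact hz.trans_le (min_le_right _ _)
  have hk := key z v hzr hv
  have ha1 : 1 ≤ ‖((coeff m φ : ℤ) : ℂ)‖ := by
    rw [Complex.norm_intCast]
    exact_mod_cast Int.one_le_abs ham
  have hzm : 0 < ‖z‖ ^ m := by positivity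
  constructor
  · rintro rfl
    rw [zero_sub, norm_neg, norm_mul, norm_pow, pow_succ] at hk
    nlinarith
  · have h2 : ‖v‖ ≤ ‖((coeff m φ : ℤ) : ℂ)‖ * ‖z‖ ^ m + T * ‖z‖ ^ (m + 1) := by
      have := norm_add_le (v - ((coeff m φ : ℤ) : ℂ) * z ^ m) (((coeff m φ : ℤ) : ℂ) * z ^ m)
      rw [sub_add_cancel, norm_mul ((coeff m φ : ℤ) : ℂ), norm_pow] at this
      linarith
    have hz1 : ‖z‖ ≤ 1 := hzr.trans hr1.le
    have h3 : ‖z‖ ^ (m + 1) ≤ ‖z‖ ^ q := pow_le_pow_of_le_one hz0'.le hz1 (by omega)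
    have h4 : ‖z‖ ^ m ≤ ‖z‖ ^ q := pow_le_pow_of_le_one hz0'.le hz1 hqm
    calc ‖v‖ ≤ _ := h2
      _ ≤ ‖((coeff m φ : ℤ) : ℂ)‖ * ‖z‖ ^ q + T * ‖z‖ ^ q := by gcongr
      _ = _ := by ring

end HasSumAt

/-- The Thue–Morse power series `∑ (-1) ^ aₙ Xⁿ`. -/
def tmSeries : ℤ⟦X⟧ := PowerSeries.mk fun n => (-1) ^ thueMorse n

theorem hasSumAt_tmSeries {z : ℂ} (hz : ‖z‖ < 1) : HasSumAt tmSeries z (fTM z) := by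
  have hs : Summable fun n => ‖((coeff n tmSeries : ℤ) : ℂ) * z ^ n‖ := by
    refine (summable_geometric_of_lt_one (norm_nonneg z) hz).congr fun n => ?_
    simp [tmSeries]
  refine ⟨hs, ?_⟩
  have h1 := hs.of_norm.hasSum
  -- The partial sums of length `2 ^ k` are exactly the partial products, so the two limits agree.
  have h2 := h1.tendsto_sum_nat.comp (tendsto_pow_atTop_atTop_of_one_lt (one_lt_two (α := ℕ)))
  have h3 := tendsto_tmProd hz
  rwa [← tendsto_nhds_unique h2 (h3.congr fun k => by simp [tmProd_eq_sum, tmSeries])]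

/-! ### Transcendence of the Thue–Morse power series -/

theorem norm_one_sub_ofReal_pow_le {x : ℝ} (h0 : 0 < x) (h1 : x < 1) (n : ℕ) :
    ‖1 - (x : ℂ) ^ n‖ ≤ n * (1 - x) ∧ ‖1 - (x : ℂ) ^ n‖ ≤ 1 := by
  have e : 1 - (x : ℂ) ^ n = ((1 - x ^ n : ℝ) : ℂ) := by push_cast; rfl
  have hb := one_add_mul_le_pow (a := x - 1) (by linarith) n
  have hp : x ^ n ≤ 1 := pow_le_one₀ h0.le h1.le
  have hp0 : 0 < x ^ n := by positivity
  rw [add_sub_cancel] at hb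
  rw [e, Complex.norm_real, Real.norm_eq_abs, abs_of_nonneg (by linarith)]
  constructor <;> nlinarith

theorem norm_fTM_ofReal_le_one {x : ℝ} (h0 : 0 < x) (h1 : x < 1) : ‖fTM x‖ ≤ 1 := by
  have hz : ‖(x : ℂ)‖ < 1 := by rwa [Complex.norm_real, Real.norm_of_nonneg h0.le]
  refine le_of_tendsto (tendsto_tmProd hz).norm (Eventually.of_forall fun k => ?_)
  rw [tmProd, norm_prod]
  exact Finset.prod_le_one (fun i _ => norm_nonneg _)
    fun i _ => (norm_one_sub_ofReal_pow_le h0 h1 _).2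

/-- `fTM x` vanishes to infinite order as `x` tends to `1` from below. -/
theorem exists_norm_fTM_ofReal_le (N : ℕ) :
    ∃ C : ℝ, ∀ x : ℝ, 0 < x → x < 1 → ‖fTM x‖ ≤ C * (1 - x) ^ N := by
  -- By Bernoulli, each of the first `N` factors is at most `2 ^ i (1 - x)`; the remaining product
  -- is at most `1`.
  refine ⟨∏ i ∈ Finset.range N, (2 ^ i : ℕ), fun x h0 h1 => ?_⟩
  have hz : ‖(x : ℂ)‖ < 1 := by rwa [Complex.norm_real, Real.norm_of_nonneg h0.le]
  have hN : ‖fTM ((x : ℂ) ^ 2 ^ N)‖ ≤ 1 := by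
    rw [← Complex.ofReal_pow]
    exact norm_fTM_ofReal_le_one (by positivity) (pow_lt_one₀ h0.le h1 (by positivity))
  rw [fTM_eq_tmProd_mul hz N, norm_mul]
  refine (mul_le_of_le_one_right (norm_nonneg _) hN).trans ?_
  rw [tmProd, norm_prod]
  refine (Finset.prod_le_prod (fun i _ => norm_nonneg _)
    fun i _ => (norm_one_sub_ofReal_pow_le h0 h1 _).1).trans ?_
  rw [Finset.prod_mul_distrib, Finset.prod_const, Finset.card_range]

/-- A polynomial that vanishes to infinite order at `1` is zero. -/
theorem Polynomial.eq_zero_of_isBigO_one_sub_pow (P : Polynomial ℤ)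
    (h : ∀ N : ℕ, ∃ C : ℝ, ∀ x : ℝ, 0 < x → x < 1 → |Polynomial.aeval x P| ≤ C * (1 - x) ^ N) :
    P = 0 := by
  by_contra hP
  obtain ⟨Q, hQ, hnd⟩ := P.exists_eq_pow_rootMultiplicity_mul_and_not_dvd hP 1
  set m := P.rootMultiplicity 1
  obtain ⟨C, hC⟩ := h (m + 1)
  have hb : ∀ x : ℝ, 0 < x → x < 1 → |Polynomial.aeval x Q| ≤ C * (1 - x) := by
    intro x h0 h1
    have h2 := hC x h0 h1
    have h3 : 0 < (1 - x) ^ m := pow_pos (by linarith) m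
    rw [hQ] at h2
    simp only [map_mul, map_pow, map_sub, Polynomial.aeval_X, map_one, abs_mul, abs_pow] at h2
    rw [abs_sub_comm, abs_of_pos (by linarith : 0 < 1 - x), pow_succ] at h2
    refine le_of_mul_le_mul_left ?_ h3
    linarith
  have hlim : Tendsto (fun x : ℝ => |Polynomial.aeval x Q|) (𝓝[<] 1)
      (𝓝 |Polynomial.aeval (1 : ℝ) Q|) :=
    ((Polynomial.continuous_aeval Q).abs.tendsto 1).mono_left nhdsWithin_le_nhds
  have hlim' : Tendsto (fun x : ℝ => C * (1 - x)) (𝓝[<] 1) (𝓝 0) := by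
    have : Continuous fun x : ℝ => C * (1 - x) := by fun_prop
    simpa using (this.tendsto 1).mono_left nhdsWithin_le_nhds
  have hle : |Polynomial.aeval (1 : ℝ) Q| ≤ 0 := by
    refine le_of_tendsto_of_tendsto hlim hlim' ?_
    filter_upwards [Ioo_mem_nhdsLT (zero_lt_one (α := ℝ))] with x hx using hb x hx.1 hx.2
  have h0 : Polynomial.aeval (1 : ℝ) Q = 0 := abs_nonpos_iff.mp hle
  apply hnd
  rw [Polynomial.dvd_iff_isRoot, Polynomial.IsRoot]
  have : ((Q.eval 1 : ℤ) : ℝ) = 0 := by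
    rw [← h0, Polynomial.aeval_def, Polynomial.eval₂_at_one]; rfl
  exact_mod_cast this

/-- The power series `φ` converges on the real interval `(0, 1)`, to a bounded function. -/
def IsBoundedOnUnitInterval (φ : ℤ⟦X⟧) : Prop :=
  ∃ C : ℝ, ∀ x : ℝ, 0 < x → x < 1 → ∃ v, HasSumAt φ x v ∧ ‖v‖ ≤ C

namespace IsBoundedOnUnitInterval

variable {φ ψ : ℤ⟦X⟧}

theorem add (hφ : IsBoundedOnUnitInterval φ) (hψ : IsBoundedOnUnitInterval ψ) :
    IsBoundedOnUnitInterval (φ + ψ) := by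
  obtain ⟨C, hC⟩ := hφ
  obtain ⟨D, hD⟩ := hψ
  refine ⟨C + D, fun x h0 h1 => ?_⟩
  obtain ⟨v, hv, hv'⟩ := hC x h0 h1
  obtain ⟨w, hw, hw'⟩ := hD x h0 h1
  exact ⟨v + w, hv.add hw, (norm_add_le _ _).trans (add_le_add hv' hw')⟩

theorem mul (hφ : IsBoundedOnUnitInterval φ) (hψ : IsBoundedOnUnitInterval ψ) :
    IsBoundedOnUnitInterval (φ * ψ) := by
  obtain ⟨C, hC⟩ := hφ
  obtain ⟨D, hD⟩ := hψ
  refine ⟨C * D, fun x h0 h1 => ?_⟩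
  obtain ⟨v, hv, hv'⟩ := hC x h0 h1
  obtain ⟨w, hw, hw'⟩ := hD x h0 h1
  refine ⟨v * w, hv.mul hw, ?_⟩
  rw [norm_mul]
  exact mul_le_mul hv' hw' (norm_nonneg _) ((norm_nonneg _).trans hv')

theorem polynomial (P : Polynomial ℤ) : IsBoundedOnUnitInterval P := by
  obtain ⟨C, hC⟩ := (isCompact_Icc (a := (0 : ℝ)) (b := 1)).exists_bound_of_continuousOn
    (f := fun x : ℝ => Polynomial.aeval (x : ℂ) P)
    ((Polynomial.continuous_aeval P).comp Complex.continuous_ofReal).continuousOn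
  exact ⟨C, fun x h0 h1 => ⟨_, HasSumAt.polynomial P x, hC x ⟨h0.le, h1.le⟩⟩⟩

theorem tmSeries : IsBoundedOnUnitInterval tmSeries := by
  refine ⟨1, fun x h0 h1 => ⟨_, hasSumAt_tmSeries ?_, norm_fTM_ofReal_le_one h0 h1⟩⟩
  rwa [Complex.norm_real, Real.norm_of_nonneg h0.le]

theorem eval₂ (Q : Polynomial (Polynomial ℤ)) :
    IsBoundedOnUnitInterval (Q.eval₂ Polynomial.coeToPowerSeries.ringHom _root_.tmSeries) := by
  have hpow (n : ℕ) : IsBoundedOnUnitInterval (_root_.tmSeries ^ n) := by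
    induction n with
    | zero => simpa using polynomial 1
    | succ n ih => simpa only [pow_succ] using ih.mul tmSeries
  induction Q using Polynomial.induction_on' with
  | add p q hp hq => simpa only [Polynomial.eval₂_add] using hp.add hq
  | monomial n a =>
    rw [Polynomial.eval₂_monomial]
    exact (polynomial a).mul (hpow n)

end IsBoundedOnUnitInterval

theorem tmSeries_ne_zero : tmSeries ≠ 0 := by
  intro h
  have := congrArg (coeff 0) h
  simp [tmSeries] at this

/-- After a power of the outer variable is divided out, a relation would express a nonzero
polynomial in `x` as `-fTM x` times a function bounded on `(0, 1)`. Such a polynomial vanishes to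
infinite order at `1`. -/
theorem eval₂_tmSeries_ne_zero {Q : Polynomial (Polynomial ℤ)} (hQ : Q ≠ 0) :
    Q.eval₂ Polynomial.coeToPowerSeries.ringHom tmSeries ≠ 0 := by
  intro h
  obtain ⟨R, hR, hnd⟩ := Q.exists_eq_pow_rootMultiplicity_mul_and_not_dvd hQ 0
  rw [map_zero, sub_zero] at hR hnd
  rw [hR, Polynomial.eval₂_mul, Polynomial.eval₂_pow, Polynomial.eval₂_X] at h
  have h := (mul_eq_zero.mp h).resolve_left (pow_ne_zero _ tmSeries_ne_zero)
  rw [← Polynomial.divX_mul_X_add R, Polynomial.eval₂_add, Polynomial.eval₂_mul,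
    Polynomial.eval₂_X, Polynomial.eval₂_C] at h
  apply hnd
  rw [Polynomial.X_dvd_iff]
  refine Polynomial.eq_zero_of_isBigO_one_sub_pow _ fun N => ?_
  obtain ⟨B, hB⟩ := IsBoundedOnUnitInterval.eval₂ R.divX
  obtain ⟨C, hC⟩ := exists_norm_fTM_ofReal_le N
  refine ⟨B * C, fun x h0 h1 => ?_⟩
  obtain ⟨v, hv, hvB⟩ := hB x h0 h1
  have hz : ‖(x : ℂ)‖ < 1 := by rwa [Complex.norm_real, Real.norm_of_nonneg h0.le]
  have hs := (hv.mul (hasSumAt_tmSeries hz)).add (HasSumAt.polynomial (R.coeff 0) x)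
  have h0' : HasSumAt 0 (x : ℂ) 0 := by simpa using HasSumAt.C 0 (x : ℂ)
  have he := (h ▸ hs : HasSumAt 0 (x : ℂ) _).eq h0'
  have hn : |Polynomial.aeval x (R.coeff 0)| = ‖v * fTM x‖ := by
    rw [eq_neg_of_add_eq_zero_left he, norm_neg, ← Real.norm_eq_abs, ← Complex.norm_real]
    congr 1
    exact (Polynomial.aeval_algebraMap_apply ℂ x (R.coeff 0)).symm
  rw [hn, norm_mul, mul_assoc]
  exact mul_le_mul hvB (hC x h0 h1) (norm_nonneg _) ((norm_nonneg _).trans hvB)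

/-- Padé-type approximation: a nontrivial integral combination of the `X ^ i * tmSeries ^ j` with
`i, j ≤ p` that vanishes to order at least `p ^ 2`. -/
theorem exists_auxiliary_series (p : ℕ) (hp : 0 < p) :
    ∃ t : Fin (p + 1) × Fin (p + 1) → ℤ,
      (∑ ij, PowerSeries.C (t ij) * X ^ (ij.1 : ℕ) * tmSeries ^ (ij.2 : ℕ)) ≠ 0 ∧
      ∀ n < p ^ 2,
        coeff n (∑ ij, PowerSeries.C (t ij) * X ^ (ij.1 : ℕ) * tmSeries ^ (ij.2 : ℕ)) = 0 := by
  let A : Matrix (Fin (p ^ 2)) (Fin (p + 1) × Fin (p + 1)) ℤ :=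
    fun n ij => coeff n (X ^ (ij.1 : ℕ) * tmSeries ^ (ij.2 : ℕ))
  -- There are `(p + 1) ^ 2` unknowns and `p ^ 2` equations. Siegel's bound on `t` is discarded,
  -- since `t` is fixed before `k` tends to infinity.
  obtain ⟨t, ht0, ht, -⟩ := Int.Matrix.exists_ne_zero_int_vec_norm_le A
    (by simp; nlinarith) (by simpa using Nat.pow_pos hp)
  refine ⟨t, ?_, fun n hn => ?_⟩
  · set Q : Polynomial (Polynomial ℤ) :=
      ∑ ij, Polynomial.monomial (ij.2 : ℕ) (Polynomial.monomial (ij.1 : ℕ) (t ij)) with hQ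
    have hQ0 : Q ≠ 0 := by
      obtain ⟨⟨i, j⟩, hij⟩ := Function.ne_iff.mp ht0
      intro h
      apply hij
      have h1 : (Q.coeff j).coeff i = 0 := by rw [h]; simp
      rw [hQ, Polynomial.finsetSum_coeff, Polynomial.finsetSum_coeff,
        Finset.sum_eq_single (i, j)] at h1
      · simpa using h1
      · rintro ⟨i', j'⟩ - hne
        rw [Polynomial.coeff_monomial]
        split_ifs with h2
        · rw [Polynomial.coeff_monomial, if_neg]
          intro h3
          exact hne (Prod.ext (Fin.ext h3) (Fin.ext h2))
        · simp
      · simp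
    have := eval₂_tmSeries_ne_zero hQ0
    rw [hQ, Polynomial.eval₂_finsetSum] at this
    convert this using 2 with ij
    rw [Polynomial.eval₂_monomial, Polynomial.coeToPowerSeries.ringHom_apply,
      Polynomial.coe_monomial]
    congr 1
    ext n
    rw [coeff_C_mul, coeff_X_pow, coeff_monomial, mul_ite, mul_one, mul_zero]
  · have h1 := congrFun ht ⟨n, hn⟩
    rw [map_sum, ← Pi.zero_apply (M := fun _ => ℤ) (⟨n, hn⟩ : Fin (p ^ 2)), ← h1, Matrix.mulVec, dotProduct]
    refine Finset.sum_congr rfl fun ij _ => ?_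
    rw [mul_assoc, coeff_C_mul, mul_comm]

/-! ### A Liouville inequality -/

/-- In a number field, the norm of a nonzero algebraic integer is at least `1` in absolute value;
hence no conjugate is too small compared with the others. -/
theorem one_le_norm_mul_pow_of_isIntegral {K : Type*} [Field K] [NumberField K] {x : K}
    (hx : IsIntegral ℤ x) (hx0 : x ≠ 0) {B : ℝ} (hB : ∀ σ : K →+* ℂ, ‖σ x‖ ≤ B) (σ₀ : K →+* ℂ) :
    1 ≤ ‖σ₀ x‖ * B ^ (Module.finrank ℚ K - 1) := by
  classical
  have hN : ∃ m : ℤ, (m : ℚ) = Algebra.norm ℚ x :=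
    IsIntegrallyClosed.isIntegral_iff.mp (Algebra.isIntegral_norm ℚ hx)
  obtain ⟨m, hm⟩ := hN
  have hm0 : m ≠ 0 := by
    rintro rfl
    exact Algebra.norm_ne_zero_iff.mpr hx0 (hm.symm.trans Int.cast_zero)
  have h1 := Algebra.norm_eq_prod_embeddings ℚ ℂ x
  rw [← hm] at h1
  have h2 : (1 : ℝ) ≤ ‖∏ σ : K →ₐ[ℚ] ℂ, σ x‖ := by
    rw [← h1]
    simp only [eq_ratCast, Rat.cast_intCast, Complex.norm_intCast]
    exact_mod_cast Int.one_le_abs hm0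
  rw [norm_prod, ← Finset.mul_prod_erase _ _ (Finset.mem_univ σ₀.toRatAlgHom)] at h2
  refine h2.trans (mul_le_mul_of_nonneg_left ?_ (norm_nonneg _))
  refine (Finset.prod_le_prod (fun _ _ => norm_nonneg _) fun σ _ => hB σ.toRingHom).trans ?_
  rw [Finset.prod_const, Finset.card_erase_of_mem (Finset.mem_univ _), Finset.card_univ,
    AlgHom.card]

/-! ### The values at `α ^ (2 ^ k)` -/

/-- `∑ tᵢⱼ x ^ (i 2 ^ k) y ^ j (∏_{l < k} (1 - x ^ (2 ^ l))) ^ (p - j)`. -/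
def auxValue {R : Type*} [CommRing R] {p : ℕ} (t : Fin (p + 1) × Fin (p + 1) → ℤ) (k : ℕ)
    (x y : R) : R :=
  ∑ ij, (t ij : R) * (x ^ (2 ^ k)) ^ (ij.1 : ℕ) * y ^ (ij.2 : ℕ) * tmProd k x ^ (p - (ij.2 : ℕ))

theorem map_tmProd {R S : Type*} [CommRing R] [CommRing S] (f : R →+* S) (k : ℕ) (x : R) :
    f (tmProd k x) = tmProd k (f x) := by
  simp [tmProd]

theorem map_auxValue {R S : Type*} [CommRing R] [CommRing S] (f : R →+* S) {p : ℕ}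
    (t : Fin (p + 1) × Fin (p + 1) → ℤ) (k : ℕ) (x y : R) :
    f (auxValue t k x y) = auxValue t k (f x) (f y) := by
  simp [auxValue, map_tmProd]

/-- The factor `tmProd k x ^ p` clears the denominators that substituting `f(α ^ 2 ^ k) = f(α) /
P_k(α)` would introduce. -/
theorem auxValue_mul_tmProd {R : Type*} [CommRing R] {p : ℕ} (t : Fin (p + 1) × Fin (p + 1) → ℤ)
    (k : ℕ) (x y : R) :
    auxValue t k x (tmProd k x * y) =
      tmProd k x ^ p * ∑ ij, (t ij : R) * (x ^ (2 ^ k)) ^ (ij.1 : ℕ) * y ^ (ij.2 : ℕ) := by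
  rw [auxValue, Finset.mul_sum]
  refine Finset.sum_congr rfl fun ij _ => ?_
  have h : tmProd k x ^ p = tmProd k x ^ (ij.2 : ℕ) * tmProd k x ^ (p - (ij.2 : ℕ)) := by
    rw [← pow_add, Nat.add_sub_cancel' (Nat.lt_succ_iff.mp ij.2.2)]
  rw [h, mul_pow]
  ring

/-- This form serves all conjugates of `α`, which may lie outside the unit disc. -/
theorem norm_tmProd_le {A : ℝ} (hA : 2 ≤ A) {x : ℂ} (hx : ‖x‖ ≤ A) (k : ℕ) :
    ‖tmProd k x‖ ≤ A ^ (2 * 2 ^ k) := by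
  have h (i : ℕ) : ‖1 - x ^ (2 ^ i)‖ ≤ A ^ (2 ^ i + 1) := by
    have h1 : 1 ≤ A ^ (2 ^ i) := one_le_pow₀ (by linarith)
    calc ‖1 - x ^ (2 ^ i)‖ ≤ 1 + ‖x‖ ^ (2 ^ i) := by
          rw [← norm_pow]; simpa only [norm_one] using norm_sub_le (1 : ℂ) (x ^ (2 ^ i))
      _ ≤ A ^ (2 ^ i) + A ^ (2 ^ i) := by gcongr
      _ ≤ A ^ (2 ^ i + 1) := by rw [pow_succ]; nlinarith
  rw [tmProd, norm_prod]
  refine (Finset.prod_le_prod (fun _ _ => norm_nonneg _) fun i _ => h i).trans ?_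
  rw [Finset.prod_pow_eq_pow_sum, Finset.sum_add_distrib]
  refine pow_le_pow_right₀ (by linarith) ?_
  have h1 : ∑ i ∈ Finset.range k, 2 ^ i < 2 ^ k := by
    rw [Nat.geomSum_eq le_rfl]; have := Nat.one_le_two_pow (n := k); omega
  have h2 : k < 2 ^ k := Nat.lt_two_pow_self
  simp only [Finset.sum_const, Finset.card_range, smul_eq_mul]
  omega

theorem norm_tmProd_le_of_norm_le_one {A : ℝ} (hA : 2 ≤ A) {x : ℂ} (hx : ‖x‖ ≤ 1) (k : ℕ) :
    ‖tmProd k x‖ ≤ A ^ (2 ^ k) := by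
  have h (i : ℕ) : ‖1 - x ^ (2 ^ i)‖ ≤ A := by
    calc ‖1 - x ^ (2 ^ i)‖ ≤ 1 + ‖x‖ ^ (2 ^ i) := by
          rw [← norm_pow]; simpa only [norm_one] using norm_sub_le (1 : ℂ) (x ^ (2 ^ i))
      _ ≤ 1 + 1 := by gcongr; exact pow_le_one₀ (norm_nonneg _) hx
      _ ≤ A := by linarith
  rw [tmProd, norm_prod]
  refine (Finset.prod_le_prod (fun _ _ => norm_nonneg _) fun i _ => h i).trans ?_
  rw [Finset.prod_const, Finset.card_range]
  exact pow_le_pow_right₀ (by linarith) Nat.lt_two_pow_self.le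

theorem norm_auxValue_le {A : ℝ} (hA : 2 ≤ A) {x y : ℂ} (hx : ‖x‖ ≤ A) (hy : ‖y‖ ≤ A) {p : ℕ}
    (t : Fin (p + 1) × Fin (p + 1) → ℤ) (k : ℕ) :
    ‖auxValue t k x y‖ ≤ (∑ ij, |(t ij : ℝ)|) * A ^ (4 * (2 ^ k * p)) := by
  rw [auxValue, Finset.sum_mul]
  refine norm_sum_le_of_le _ fun ij _ => ?_
  have hA1 : 1 ≤ A := by linarith
  have hi : (ij.1 : ℕ) ≤ p := Nat.lt_succ_iff.mp ij.1.2
  have hj : (ij.2 : ℕ) ≤ p := Nat.lt_succ_iff.mp ij.2.2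
  have hk : 1 ≤ 2 ^ k := Nat.one_le_two_pow
  rw [norm_mul, norm_mul, norm_mul, Complex.norm_intCast, mul_assoc, mul_assoc]
  refine mul_le_mul_of_nonneg_left ?_ (abs_nonneg _)
  rw [norm_pow, norm_pow, norm_pow, norm_pow]
  calc (‖x‖ ^ 2 ^ k) ^ (ij.1 : ℕ) * (‖y‖ ^ (ij.2 : ℕ) * ‖tmProd k x‖ ^ (p - (ij.2 : ℕ)))
      ≤ (A ^ 2 ^ k) ^ (ij.1 : ℕ) * (A ^ (ij.2 : ℕ) * (A ^ (2 * 2 ^ k)) ^ (p - (ij.2 : ℕ))) := by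
        gcongr
        exact norm_tmProd_le hA hx k
    _ = A ^ (2 ^ k * ij.1 + (ij.2 + 2 * 2 ^ k * (p - ij.2))) := by
        rw [← pow_mul, ← pow_mul, ← pow_add, ← pow_add]
    _ ≤ A ^ (4 * (2 ^ k * p)) := by
        refine pow_le_pow_right₀ hA1 ?_
        have h1 : 2 ^ k * (ij.1 : ℕ) ≤ 2 ^ k * p := Nat.mul_le_mul_left _ hi
        have h2 : 2 ^ k * (p - (ij.2 : ℕ)) ≤ 2 ^ k * p := Nat.mul_le_mul_left _ (Nat.sub_le _ _)
        have h3 : (ij.2 : ℕ) ≤ 2 ^ k * p := hj.trans (Nat.le_mul_of_pos_left p hk)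
        rw [mul_assoc 2]
        omega

/-! ### Denominators -/

section Denominators

variable {K : Type*} [CommRing K]

theorem IsIntegral.natCast_pow_mul_mono {D : ℕ} {x : K} {m n : ℕ} (hmn : m ≤ n)
    (h : IsIntegral ℤ ((D : K) ^ m * x)) : IsIntegral ℤ ((D : K) ^ n * x) := by
  have e : (D : K) ^ n * x = (D : K) ^ (n - m) * ((D : K) ^ m * x) := by
    rw [← mul_assoc, ← pow_add, Nat.sub_add_cancel hmn]
  rw [e]
  exact ((isIntegral_natCast (R := ℤ) D).pow _).mul h

theorem IsIntegral.natCast_pow_mul_mul {D : ℕ} {x y : K} {m n : ℕ}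
    (hx : IsIntegral ℤ ((D : K) ^ m * x)) (hy : IsIntegral ℤ ((D : K) ^ n * y)) :
    IsIntegral ℤ ((D : K) ^ (m + n) * (x * y)) := by
  have e : (D : K) ^ (m + n) * (x * y) = ((D : K) ^ m * x) * ((D : K) ^ n * y) := by ring
  rw [e]
  exact hx.mul hy

theorem IsIntegral.natCast_pow_mul_pow {D : ℕ} {x : K} {m : ℕ}
    (hx : IsIntegral ℤ ((D : K) ^ m * x)) (n : ℕ) :
    IsIntegral ℤ ((D : K) ^ (m * n) * x ^ n) := by
  rw [pow_mul, ← mul_pow]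
  exact hx.pow n

theorem isIntegral_natCast_pow_mul_tmProd {D : ℕ} {x : K} (hx : IsIntegral ℤ ((D : K) * x))
    (k : ℕ) : IsIntegral ℤ ((D : K) ^ (2 ^ k) * tmProd k x) := by
  induction k with
  -- The exponent `2 ^ k - 1` would suffice; the spare factor `D` makes the exponent simply double
  -- at each step.
  | zero => simpa [tmProd] using isIntegral_natCast (R := ℤ) (B := K) D
  | succ k ih =>
    rw [tmProd, Finset.prod_range_succ, pow_succ 2 k, mul_two]
    refine ih.natCast_pow_mul_mul ?_
    rw [mul_sub, mul_one, ← mul_pow]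
    exact ((isIntegral_natCast (R := ℤ) D).pow _).sub (hx.pow _)

theorem isIntegral_natCast_pow_mul_auxValue {D : ℕ} {x y : K} (hx : IsIntegral ℤ ((D : K) * x))
    (hy : IsIntegral ℤ ((D : K) * y)) {p : ℕ} (t : Fin (p + 1) × Fin (p + 1) → ℤ) (k : ℕ) :
    IsIntegral ℤ ((D : K) ^ (3 * (2 ^ k * p)) * auxValue t k x y) := by
  rw [auxValue, Finset.mul_sum]
  refine IsIntegral.sum _ fun ij _ => ?_
  have hi : (ij.1 : ℕ) ≤ p := Nat.lt_succ_iff.mp ij.1.2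
  have hj : (ij.2 : ℕ) ≤ p := Nat.lt_succ_iff.mp ij.2.2
  have hk : 1 ≤ 2 ^ k := Nat.one_le_two_pow
  have h0 : IsIntegral ℤ ((D : K) ^ 0 * (t ij : K)) := by
    simpa using isIntegral_algebraMap (R := ℤ) (A := K) (x := t ij)
  have h1 : IsIntegral ℤ ((D : K) ^ (2 ^ k * (ij.1 : ℕ)) * (x ^ 2 ^ k) ^ (ij.1 : ℕ)) := by
    rw [← pow_mul, ← mul_pow]; exact hx.pow _
  have h2 : IsIntegral ℤ ((D : K) ^ (ij.2 : ℕ) * y ^ (ij.2 : ℕ)) := by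
    rw [← mul_pow]; exact hy.pow _
  have h3 := (isIntegral_natCast_pow_mul_tmProd hx k).natCast_pow_mul_pow (p - (ij.2 : ℕ))
  refine (((h0.natCast_pow_mul_mul h1).natCast_pow_mul_mul h2).natCast_pow_mul_mul
    h3).natCast_pow_mul_mono ?_
  have h1 : 2 ^ k * (ij.1 : ℕ) ≤ 2 ^ k * p := Nat.mul_le_mul_left _ hi
  have h2 : 2 ^ k * (p - (ij.2 : ℕ)) ≤ 2 ^ k * p := Nat.mul_le_mul_left _ (Nat.sub_le _ _)
  have h3 : (ij.2 : ℕ) ≤ 2 ^ k * p := hj.trans (Nat.le_mul_of_pos_left p hk)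
  omega

end Denominators

theorem exists_natCast_mul_isIntegral {K : Type*} [Field K] [NumberField K] (x : K) :
    ∃ D : ℕ, D ≠ 0 ∧ IsIntegral ℤ ((D : K) * x) := by
  obtain ⟨d, hd, h⟩ := 
    ((IsFractionRing.isAlgebraic_iff ℤ ℚ K).mpr
      (Algebra.IsAlgebraic.isAlgebraic x)).exists_integral_multiple
  refine ⟨d.natAbs, Int.natAbs_ne_zero.mpr hd, ?_⟩
  rw [zsmul_eq_mul] at h
  rcases Int.natAbs_eq d with e | e
  · rw [e] at h; simpa using h
  · rw [e] at h; simpa using h.neg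

/-- The size estimate behind Mahler's method, for algebraic `α` and `fTM α`: all the constants are
independent of the parameter `p`, except `M`, `S` and the threshold on `k`. -/
theorem one_le_of_isAlgebraic_fTM {α : ℂ} (hα : IsAlgebraic ℚ α) (hα0 : 0 < ‖α‖) (hα1 : ‖α‖ < 1)
    (hβ : IsAlgebraic ℚ (fTM α)) :
    ∃ (A : ℝ) (d : ℕ), 2 ≤ A ∧ 0 < d ∧ ∀ p : ℕ, 0 < p → ∃ M S : ℝ, 0 ≤ M ∧ 0 ≤ S ∧
      ∀ᶠ k : ℕ in atTop, 1 ≤ A ^ (4 * (2 ^ k * p)) * (M * ‖α‖ ^ (2 ^ k * p * p)) *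
        (S * A ^ (7 * (2 ^ k * p))) ^ (d - 1) := by
  classical
  let K := IntermediateField.adjoin ℚ {α, fTM α}
  have hfin : FiniteDimensional ℚ K := by
    refine IntermediateField.finiteDimensional_adjoin ?_
    rintro x (rfl | rfl)
    exacts [hα.isIntegral, hβ.isIntegral]
  have : NumberField K := ⟨⟩
  let a : K := ⟨α, IntermediateField.subset_adjoin _ _ (by simp)⟩
  let b : K := ⟨fTM α, IntermediateField.subset_adjoin _ _ (by simp)⟩
  let σ₀ : K →+* ℂ := K.val.toRingHom
  have hσa : σ₀ a = α := rfl
  have hσb : σ₀ b = fTM α := rfl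
  obtain ⟨Da, hDa0, hDa⟩ := exists_natCast_mul_isIntegral a
  obtain ⟨Db, hDb0, hDb⟩ := exists_natCast_mul_isIntegral b
  set D := Da * Db with hD
  have hD0 : D ≠ 0 := mul_ne_zero hDa0 hDb0
  have hDa' : IsIntegral ℤ ((D : K) * a) := by
    have := (isIntegral_natCast (R := ℤ) (B := K) Db).mul hDa
    rw [hD, Nat.cast_mul, mul_comm (Da : K), mul_assoc]; exact this
  have hDb' : IsIntegral ℤ ((D : K) * b) := by
    have := (isIntegral_natCast (R := ℤ) (B := K) Da).mul hDb
    rw [hD, Nat.cast_mul, mul_assoc]; exact this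
  set Sa := ∑ σ : K →+* ℂ, ‖σ a‖
  set Sb := ∑ σ : K →+* ℂ, ‖σ b‖
  have hSa (σ : K →+* ℂ) : ‖σ a‖ ≤ Sa :=
    Finset.single_le_sum (f := fun σ : K →+* ℂ => ‖σ a‖) (fun _ _ => norm_nonneg _)
      (Finset.mem_univ σ)
  have hSb (σ : K →+* ℂ) : ‖σ b‖ ≤ Sb :=
    Finset.single_le_sum (f := fun σ : K →+* ℂ => ‖σ b‖) (fun _ _ => norm_nonneg _)
      (Finset.mem_univ σ)
  have hSa0 : 0 ≤ Sa := (norm_nonneg _).trans (hSa σ₀)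
  have hSb0 : 0 ≤ Sb := (norm_nonneg _).trans (hSb σ₀)
  have hDr : (0 : ℝ) ≤ D := Nat.cast_nonneg D
  obtain ⟨A, hA2, hAD, hAa, hAb⟩ : ∃ A : ℝ, 2 ≤ A ∧ (D : ℝ) ≤ A ∧ Sa ≤ A ∧ Sb ≤ A :=
    ⟨2 + D + Sa + Sb, by linarith, by linarith, by linarith, by linarith⟩
  have hA0 : 0 ≤ A := by linarith
  refine ⟨A, Module.finrank ℚ K, hA2, Module.finrank_pos, fun p hp => ?_⟩
  obtain ⟨t, ht0, ht⟩ := exists_auxiliary_series p hp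
  have hE {z : ℂ} (hz : ‖z‖ < 1) :
      HasSumAt (∑ ij, PowerSeries.C (t ij) * X ^ (ij.1 : ℕ) * tmSeries ^ (ij.2 : ℕ)) z
        (∑ ij, (t ij : ℂ) * z ^ (ij.1 : ℕ) * fTM z ^ (ij.2 : ℕ)) :=
    HasSumAt.sum _ fun ij _ =>
      ((HasSumAt.C (t ij) z).mul ((HasSumAt.X z).pow _)).mul ((hasSumAt_tmSeries hz).pow _)
  obtain ⟨M, hM⟩ := HasSumAt.exists_bound_nhdsNE_zero ht0 ht (norm_pos_iff.mp hα0) hα1 (hE hα1)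
  -- Zeros of `E` do not accumulate at `0`, so its values at these points are eventually nonzero.
  have hlim : Tendsto (fun k : ℕ => α ^ (2 ^ k)) atTop (𝓝[≠] 0) := by
    refine tendsto_nhdsWithin_iff.mpr ⟨?_, Eventually.of_forall fun k => ?_⟩
    · exact (tendsto_pow_atTop_nhds_zero_of_norm_lt_one hα1).comp
        (tendsto_pow_atTop_atTop_of_one_lt one_lt_two)
    · exact pow_ne_zero _ (norm_pos_iff.mp hα0)
  refine ⟨|M|, ∑ ij, |(t ij : ℝ)|, abs_nonneg M, Finset.sum_nonneg fun _ _ => abs_nonneg _, ?_⟩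
  filter_upwards [hlim.eventually hM] with k hk
  have hz : ‖α ^ (2 ^ k)‖ < 1 := by
    rw [norm_pow]; exact pow_lt_one₀ hα0.le hα1 (by positivity)
  obtain ⟨hv0, hvM⟩ := hk _ (hE hz)
  set v := ∑ ij, (t ij : ℂ) * (α ^ (2 ^ k)) ^ (ij.1 : ℕ) * fTM (α ^ (2 ^ k)) ^ (ij.2 : ℕ) with hv
  have hprod0 : tmProd k α ≠ 0 := by
    refine Finset.prod_ne_zero_iff.mpr fun i _ h => ?_
    have h1 : ‖α ^ (2 ^ i)‖ < 1 := by
      rw [norm_pow]; exact pow_lt_one₀ hα0.le hα1 (by positivity)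
    rw [← sub_eq_zero.mp h, norm_one] at h1
    exact lt_irrefl _ h1
  set x : K := (D : K) ^ (3 * (2 ^ k * p)) * auxValue t k a b with hx
  have hxi : IsIntegral ℤ x := isIntegral_natCast_pow_mul_auxValue hDa' hDb' t k
  have hσx (σ : K →+* ℂ) :
      σ x = (D : ℂ) ^ (3 * (2 ^ k * p)) * auxValue t k (σ a) (σ b) := by
    rw [hx, map_mul, map_pow, map_natCast, map_auxValue]
  have hσ₀x : σ₀ x = (D : ℂ) ^ (3 * (2 ^ k * p)) * (tmProd k α ^ p * v) := by
    rw [hσx, hσa, hσb, fTM_eq_tmProd_mul hα1 k, auxValue_mul_tmProd]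
  have hx0 : x ≠ 0 := by
    intro h
    have h1 : σ₀ x ≠ 0 := by
      rw [hσ₀x]
      exact mul_ne_zero (pow_ne_zero _ (Nat.cast_ne_zero.mpr hD0))
        (mul_ne_zero (pow_ne_zero _ hprod0) hv0)
    exact h1 (by rw [h, map_zero])
  -- `7 = 3 + 4`: the denominator and the size of `auxValue`.
  have hB (σ : K →+* ℂ) : ‖σ x‖ ≤ (∑ ij, |(t ij : ℝ)|) * A ^ (7 * (2 ^ k * p)) := by
    rw [hσx, norm_mul, norm_pow, Complex.norm_natCast]
    calc (D : ℝ) ^ (3 * (2 ^ k * p)) * ‖auxValue t k (σ a) (σ b)‖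
        ≤ A ^ (3 * (2 ^ k * p)) * ((∑ ij, |(t ij : ℝ)|) * A ^ (4 * (2 ^ k * p))) := by
          gcongr
          exact norm_auxValue_le hA2 ((hSa σ).trans hAa) ((hSb σ).trans hAb) t k
      _ = _ := by ring
  -- `4 = 3 + 1`: the denominator and `tmProd k α ^ p`.
  have hsmall : ‖σ₀ x‖ ≤ A ^ (4 * (2 ^ k * p)) * (|M| * ‖α‖ ^ (2 ^ k * p * p)) := by
    rw [hσ₀x, norm_mul, norm_mul, norm_pow, norm_pow, Complex.norm_natCast]
    have hP := norm_tmProd_le_of_norm_le_one hA2 hα1.le k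
    have hv' : ‖v‖ ≤ |M| * ‖α‖ ^ (2 ^ k * p * p) := by
      refine hvM.trans ?_
      rw [norm_pow, ← pow_mul, mul_assoc, ← sq]
      gcongr
      exact le_abs_self M
    calc (D : ℝ) ^ (3 * (2 ^ k * p)) * (‖tmProd k α‖ ^ p * ‖v‖)
        ≤ A ^ (3 * (2 ^ k * p)) * ((A ^ (2 ^ k)) ^ p * (|M| * ‖α‖ ^ (2 ^ k * p * p))) := by
          gcongr
      _ = _ := by ring
  refine (one_le_norm_mul_pow_of_isIntegral hxi hx0 hB σ₀).trans ?_
  gcongr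

theorem transcendental_fTM {α : ℂ} (hα : IsAlgebraic ℚ α) (hα0 : 0 < ‖α‖) (hα1 : ‖α‖ < 1) :
    Transcendental ℚ (fTM α) := by
  intro hβ
  obtain ⟨A, d, hA, hd, h⟩ := one_le_of_isAlgebraic_fTM hα hα0 hα1 hβ
  have hA0 : 0 < A ^ (7 * d) := by positivity
  -- The total exponent of `A` is `4 + 7 (d - 1) ≤ 7 d` per unit of `N`, so this `p` makes the
  -- `N`-th root of the main term at most `1 / 2`. Only then are `M` and `S` fixed, to be absorbed
  -- by large `k`.
  obtain ⟨p, hp⟩ := exists_pow_lt_of_lt_one (show 0 < 1 / 2 / A ^ (7 * d) by positivity) hα1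
  have hp' : A ^ (7 * d) * ‖α‖ ^ (p + 1) ≤ 1 / 2 := by
    rw [lt_div_iff₀' hA0] at hp
    refine le_trans ?_ hp.le
    gcongr A ^ (7 * d) * ?_
    exact pow_le_pow_of_le_one hα0.le hα1.le (Nat.le_succ p)
  obtain ⟨M, S, hM, hS, hk⟩ := h (p + 1) p.succ_pos
  have hlim : Tendsto (fun k : ℕ => M * S ^ (d - 1) * (1 / 2 : ℝ) ^ k) atTop (𝓝 0) := by
    simpa using (tendsto_pow_atTop_nhds_zero_of_lt_one (by norm_num : (0 : ℝ) ≤ 1 / 2)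
      (by norm_num)).const_mul (M * S ^ (d - 1))
  obtain ⟨k, hk1, hk2⟩ := (hk.and (hlim.eventually_lt_const one_pos)).exists
  refine absurd hk1 (not_le.mpr (lt_of_le_of_lt ?_ hk2))
  set N := 2 ^ k * (p + 1) with hN
  have hkN : k ≤ N := Nat.lt_two_pow_self.le.trans (Nat.le_mul_of_pos_right _ p.succ_pos)
  calc A ^ (4 * N) * (M * ‖α‖ ^ (N * (p + 1))) * (S * A ^ (7 * N)) ^ (d - 1)
      = M * S ^ (d - 1) * (A ^ (4 + 7 * (d - 1)) * ‖α‖ ^ (p + 1)) ^ N := by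
        rw [mul_pow, mul_pow, ← pow_mul, ← pow_mul, ← pow_mul, add_mul, pow_add]
        ring
    _ ≤ M * S ^ (d - 1) * (A ^ (7 * d) * ‖α‖ ^ (p + 1)) ^ N := by
        gcongr
        · linarith
        · omega
    _ ≤ M * S ^ (d - 1) * (1 / 2) ^ N := by gcongr
    _ ≤ M * S ^ (d - 1) * (1 / 2) ^ k := by
        gcongr _ * ?_
        exact pow_le_pow_of_le_one (by norm_num) (by norm_num) hkN

theorem mainTheorem5 (α : ℂ) (hα : IsAlgebraic ℚ α) (hα0 : 0 < ‖α‖) (hα1 : ‖α‖ < 1) :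
    HasProd (fun n : ℕ => 1 - α ^ (2 ^ n)) (fTM α) ∧
      HasSum (fun n : ℕ => (-1 : ℂ) ^ thueMorse n * α ^ n) (fTM α) ∧
      Transcendental ℚ (fTM α) := by
  refine ⟨hasProd_fTM hα1, ?_, transcendental_fTM hα hα0 hα1⟩
  simpa [tmSeries] using (hasSumAt_tmSeries hα1).2
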